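/- For an immersed surface $\Sigma$ in $\mathbb R^3$ with unit normal $\nu=(\nu_1,\nu_2,\nu_3)$, $\nu_3\neq 0$, the anisotropic mean curvature for the Dirichlet energy $\int_\Sigma F(\nu)\,d\Sigma$, $F(\nu)=\frac1{\nu_3}-\nu_3$, is $\Lambda=2HF(\nu)-\operatorname{div}_\Sigma (DF(\nu))$, where $H$ is the mean curvature and $DF$ is the gradient of $F$ on the unit sphere; $\Sigma$ is called anisotropic minimal if $\Lambda=0$ identically. Let $I\subset\mathbb R$ be an open interval and let $\mathbf c,\mathbf u,\mathbf v\colon I\to\mathbb R^3$ and $r\colon I\to(0,\infty)$ be smooth, with $\mathbf u(s),\mathbf v(s)$ orthonormal for every $s$. They describe a smooth one-parameter family of circles, in the planes $P_s=\mathbf c(s)+\operatorname{span}\{\mathbf u(s),\mathbf v(s)\}$ (the planes of the foliation), swept out by $$X(s,\theta)=\mathbf c(s)+r(s)\bigl(\cos\theta\,\mathbf u(s)+\sin\theta\,\mathbf v(s)\bigr).$$ Let $U\subset I\times\mathbb R$ be an open set that contains, for every $s\in I$, a point $(s,\theta)$ (for instance $U=I\times\mathbb R$), and suppose that $X$ is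 an immersion with $\nu_3\neq0$ on $U$, so that $\Sigma=X(U)$ is a cyclic surface. **Theorem.** If the cyclic surface $\Sigma$ is anisotropic minimal for the Dirichlet energy and is not contained in a plane, then all planes $P_s$, $s\in I$, of the foliation are parallel to the $xy$-plane. -/

import Mathlib

open scoped ContDiff Matrix

noncomputable section

/-- Euclidean space `ℝ³`, with coordinates `(x, y, z) = (p 0, p 1, p 2)`. -/
abbrev E3 : Type := EuclideanSpace ℝ (Fin 3)

/-- The cross product of `ℝ³`. -/
def cross (v w : E3) : E3 := WithLp.toLp 2 (v.ofLp ⨯₃ w.ofLp)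

/-! ### Differential geometry of a parametrized surface `X = X(s, θ)` -/

/-- The partial derivative in the first variable `s`. -/
def partialS (X : ℝ → ℝ → E3) (s θ : ℝ) : E3 := deriv (fun t => X t θ) s

/-- The partial derivative in the second variable `θ`. -/
def partialT (X : ℝ → ℝ → E3) (s θ : ℝ) : E3 := deriv (fun t => X s t) θ

/-- The normal vector `X_s × X_θ` (nonzero exactly where `X` is an immersion). -/
def normalVec (X : ℝ → ℝ → E3) (s θ : ℝ) : E3 := cross (partialS X s θ) (partialT X s θ)

/-- The unit normal `ν = (X_s × X_θ) / |X_s × X_θ|`. -/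
def unitNormal (X : ℝ → ℝ → E3) (s θ : ℝ) : E3 :=
  ‖normalVec X s θ‖⁻¹ • normalVec X s θ

/-- The trace `∑ g^{ij} b_{ij}` of a (possibly non-symmetric) bilinear form on the tangent plane,
with coefficients `b_{ij}` in the basis `X_s, X_θ`, with respect to the first fundamental form. -/
def metricTrace (X : ℝ → ℝ → E3) (s θ b₁₁ b₁₂ b₂₁ b₂₂ : ℝ) : ℝ :=
  let E := inner ℝ (partialS X s θ) (partialS X s θ)
  let F := inner ℝ (partialS X s θ) (partialT X s θ)
  let G := inner ℝ (partialT X s θ) (partialT X s θ)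
  (G * b₁₁ - F * b₁₂ - F * b₂₁ + E * b₂₂) / (E * G - F ^ 2)

/-- The mean curvature `H`: half the trace of the second fundamental form
`h(X_i, X_j) = ⟨ν, X_{ij}⟩`. -/
def meanCurvature (X : ℝ → ℝ → E3) (s θ : ℝ) : ℝ :=
  metricTrace X s θ
    (inner ℝ (unitNormal X s θ) (partialS (partialS X) s θ))
    (inner ℝ (unitNormal X s θ) (partialT (partialS X) s θ))
    (inner ℝ (unitNormal X s θ) (partialS (partialT X) s θ))
    (inner ℝ (unitNormal X s θ) (partialT (partialT X) s θ)) / 2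

/-- The divergence `div_Σ V = ∑ g^{ij} ⟨∂_i V, X_j⟩` of a vector field `V` along the surface. -/
def surfaceDiv (X V : ℝ → ℝ → E3) (s θ : ℝ) : ℝ :=
  metricTrace X s θ
    (inner ℝ (partialS V s θ) (partialS X s θ))
    (inner ℝ (partialS V s θ) (partialT X s θ))
    (inner ℝ (partialT V s θ) (partialS X s θ))
    (inner ℝ (partialT V s θ) (partialT X s θ))

/-! ### Anisotropic surface energies -/

/-- The gradient `DF` on the unit sphere, at a unit vector `ν`, of (the restriction of) `F`:
the component of the Euclidean gradient tangent to the sphere. It depends only on the values of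
`F` on the sphere. -/
def sphereGradient (F : E3 → ℝ) (ν : E3) : E3 :=
  gradient F ν - (inner ℝ (gradient F ν) ν : ℝ) • ν

/-- The anisotropic mean curvature `Λ = 2 H F(ν) - div_Σ (DF(ν))` of the surface `X` for the
energy `∫ F(ν) dΣ`. -/
def anisotropicMeanCurvature (F : E3 → ℝ) (X : ℝ → ℝ → E3) (s θ : ℝ) : ℝ :=
  2 * meanCurvature X s θ * F (unitNormal X s θ)
    - surfaceDiv X (fun s' θ' => sphereGradient F (unitNormal X s' θ')) s θ

/-- The density `F(ν) = 1/ν₃ - ν₃` of the Dirichlet energy (meaningful where `ν₃ ≠ 0`). -/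
def dirichletDensity (ν : E3) : ℝ := 1 / ν 2 - ν 2

/-- The surface parametrized by `X` on `U` is an anisotropic minimal surface of the Dirichlet
energy: `X` is an immersion on `U`, its unit normal stays in the domain `ν₃ ≠ 0` of the density,
and `Λ = 0`. -/
def IsDirichletMinimalOn (X : ℝ → ℝ → E3) (U : Set (ℝ × ℝ)) : Prop :=
  ∀ p ∈ U, normalVec X p.1 p.2 ≠ 0 ∧ unitNormal X p.1 p.2 2 ≠ 0 ∧
    anisotropicMeanCurvature dirichletDensity X p.1 p.2 = 0

/-! ### Cyclic surfaces -/

/-- A smooth one-parameter family of circles of `ℝ³`, with parameter `s` in an open interval `I`: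
the circle of parameter `s` has centre `c s` and radius `r s > 0`, and lies in the plane through
`c s` spanned by the orthonormal vectors `u s`, `v s`. -/
structure CircleFamily where
  I : Set ℝ
  isOpen_I : IsOpen I
  ordConnected_I : I.OrdConnected
  c : ℝ → E3
  r : ℝ → ℝ
  u : ℝ → E3
  v : ℝ → E3
  smooth_c : ContDiffOn ℝ ∞ c I
  smooth_r : ContDiffOn ℝ ∞ r I
  smooth_u : ContDiffOn ℝ ∞ u I
  smooth_v : ContDiffOn ℝ ∞ v I
  r_pos : ∀ s ∈ I, 0 < r s
  norm_u : ∀ s ∈ I, ‖u s‖ = 1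
  norm_v : ∀ s ∈ I, ‖v s‖ = 1
  inner_u_v : ∀ s ∈ I, inner ℝ (u s) (v s) = 0

/-- The map `X(s, θ) = c(s) + r(s) (cos θ u(s) + sin θ v(s))` swept out by the circles. -/
def CircleFamily.param (C : CircleFamily) (s θ : ℝ) : E3 :=
  C.c s + C.r s • (Real.cos θ • C.u s + Real.sin θ • C.v s)

/-- The plane of the foliation containing the circle of parameter `s`. -/
def CircleFamily.plane (C : CircleFamily) (s : ℝ) : AffineSubspace ℝ E3 :=
  AffineSubspace.mk' (C.c s) (Submodule.span ℝ {C.u s, C.v s})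

/-- `U` is an admissible parameter domain for a surface foliated by the circles of `C`: an open
subset of `I × ℝ` that meets every circle. The choice `U = I × ℝ` gives the whole circles; smaller
`U` allow to leave out points, for instance those where `ν₃ = 0`. -/
def CircleFamily.IsDomain (C : CircleFamily) (U : Set (ℝ × ℝ)) : Prop :=
  IsOpen U ∧ (∀ p ∈ U, p.1 ∈ C.I) ∧ ∀ s ∈ C.I, ∃ θ, (s, θ) ∈ U

/-- The surface `X(U)` in `ℝ³`. -/
def CircleFamily.surface (C : CircleFamily) (U : Set (ℝ × ℝ)) : Set E3 :=
  (fun p : ℝ × ℝ => C.param p.1 p.2) '' U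

/-- The `xy`-plane `{z = 0}`. -/
def xyPlane : AffineSubspace ℝ E3 :=
  AffineSubspace.mk' 0
    (Submodule.span ℝ {EuclideanSpace.single 0 1, EuclideanSpace.single 1 1})

end

/-! Anisotropic minimality for the Dirichlet energy means that the surface, as a graph over the
xy-plane, is harmonic (`laplaceDefect_eq_zero`). Along one circle this becomes the vanishing of a
homogeneous quintic in (T, C, S) at (1, cos θ, sin θ), with coefficients from the 2-jet of the
family. Vanishing on an arc forces vanishing on the whole complexified conic C² + S² = T², including
its point at infinity (0 : 1 : i).

At that point only w = u + iv survives, and the equation reads w₃² det(w, w', w'') = 0. If the plane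
is not horizontal, w₃ ≠ 0; since w is isotropic, the Gram determinant of w, w', w'' is -(w'·w')³, so
w'·w' = 0. Its real and imaginary parts say that u' and v' stay in span{u, v}, so n = u × v is
stationary (`tripleDet_eq_zero`, `deriv_u_v_eq`).

Where the planes are thus locally parallel and not horizontal, the equation is explicit. A motion of
the centre across the planes would make c' vertical and r' = 0, hence ν₃ = 0, which is excluded
(`vertical_of_parallel`). So the circles move inside their plane.

Finally u₃² + v₃² has zero derivative on all of I, so one non-horizontal plane makes every plane
non-horizontal. Then n and n·c are constant, and the surface lies in a plane. -/

open scoped ContDiff Matrix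

/-! ### The parametric Laplace equation -/

section Algebra

variable {K : Type*} [CommRing K]

/-- The determinant of three vectors of `K³`. -/
def tripleDet (p q a : Fin 3 → K) : K :=
  (p 1 * q 2 - p 2 * q 1) * a 0 + (p 2 * q 0 - p 0 * q 2) * a 1 + (p 0 * q 1 - p 1 * q 0) * a 2

/-- For a surface with first derivatives `p = X_s`, `q = X_θ` and second derivatives `a = X_ss`,
`b = X_sθ`, `d = X_θθ` that is a graph `z = f(x, y)`, this is `Δf` times the cube of the Jacobian
of the projection to the `xy`-plane. -/
def laplaceDefect (p q a b d : Fin 3 → K) : K :=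
  (q 0 ^ 2 + q 1 ^ 2) * tripleDet p q a - 2 * (p 0 * q 0 + p 1 * q 1) * tripleDet p q b
    + (p 0 ^ 2 + p 1 ^ 2) * tripleDet p q d

/-- The 2-jet of a family of circles at a parameter value. -/
structure CircleJet (K : Type*) where
  c₁ : Fin 3 → K
  c₂ : Fin 3 → K
  u₀ : Fin 3 → K
  u₁ : Fin 3 → K
  u₂ : Fin 3 → K
  v₀ : Fin 3 → K
  v₁ : Fin 3 → K
  v₂ : Fin 3 → K
  r₀ : K
  r₁ : K
  r₂ : K

namespace CircleJet

variable (j : CircleJet K)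

/-- The derivative `X_s`, homogenized: the point of the circle is `(C / T, S / T)`. -/
def derS (T C S : K) : Fin 3 → K := fun i =>
  T * j.c₁ i + j.r₁ * (C * j.u₀ i + S * j.v₀ i) + j.r₀ * (C * j.u₁ i + S * j.v₁ i)

/-- The derivative `X_θ`, homogenized. -/
def derT (C S : K) : Fin 3 → K := fun i => j.r₀ * (-S * j.u₀ i + C * j.v₀ i)

/-- The derivative `X_ss`, homogenized. -/
def derSS (T C S : K) : Fin 3 → K := fun i =>
  T * j.c₂ i + j.r₂ * (C * j.u₀ i + S * j.v₀ i) + 2 * j.r₁ * (C * j.u₁ i + S * j.v₁ i)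
    + j.r₀ * (C * j.u₂ i + S * j.v₂ i)

/-- The derivative `X_sθ`, homogenized. -/
def derST (C S : K) : Fin 3 → K := fun i =>
  j.r₁ * (-S * j.u₀ i + C * j.v₀ i) + j.r₀ * (-S * j.u₁ i + C * j.v₁ i)

/-- The derivative `X_θθ`, homogenized. -/
def derTT (C S : K) : Fin 3 → K := fun i => -j.r₀ * (C * j.u₀ i + S * j.v₀ i)

/-- The homogenized Laplace defect along a circle. -/
def defect (T C S : K) : K :=
  laplaceDefect (j.derS T C S) (j.derT C S) (j.derSS T C S) (j.derST C S) (j.derTT C S)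

/-- Extension of scalars. -/
def map {L : Type*} [CommRing L] (φ : K →+* L) : CircleJet L where
  c₁ := φ ∘ j.c₁
  c₂ := φ ∘ j.c₂
  u₀ := φ ∘ j.u₀
  u₁ := φ ∘ j.u₁
  u₂ := φ ∘ j.u₂
  v₀ := φ ∘ j.v₀
  v₁ := φ ∘ j.v₁
  v₂ := φ ∘ j.v₂
  r₀ := φ j.r₀
  r₁ := φ j.r₁
  r₂ := φ j.r₂

theorem defect_map {L : Type*} [CommRing L] (φ : K →+* L) (T C S : K) :
    (j.map φ).defect (φ T) (φ C) (φ S) = φ (j.defect T C S) := by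
  simp only [defect, laplaceDefect, tripleDet, derS, derT, derSS, derST, derTT, map,
    Function.comp_apply, map_add, map_sub, map_mul, map_neg, map_pow, map_ofNat]

theorem laplaceDefect_smul (t : K) (p q a b d : Fin 3 → K) :
    laplaceDefect (t • p) (t • q) (t • a) (t • b) (t • d) = t ^ 5 * laplaceDefect p q a b d := by
  simp only [laplaceDefect, tripleDet, Pi.smul_apply, smul_eq_mul]
  ring

/-- Homogeneity of degree 5 allows evaluation at points of the projective conic C² + S² = T², where
T may vanish. -/
theorem defect_mul (t T C S : K) :
    j.defect (t * T) (t * C) (t * S) = t ^ 5 * j.defect T C S := by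
  rw [defect, defect, ← laplaceDefect_smul]
  congr 1 <;> funext i <;>
    simp only [derS, derT, derSS, derST, derTT, Pi.smul_apply, smul_eq_mul] <;> ring

/-- The leading coefficient of the Laplace defect, in terms of the isotropic vector
`w = u + i v`. -/
theorem defect_zero_one_I (j : CircleJet ℂ) :
    j.defect 0 1 Complex.I = -Complex.I * j.r₀ ^ 5 *
      ((j.u₀ 0 + Complex.I * j.v₀ 0) ^ 2 + (j.u₀ 1 + Complex.I * j.v₀ 1) ^ 2) *
      tripleDet (fun i => j.u₀ i + Complex.I * j.v₀ i) (fun i => j.u₁ i + Complex.I * j.v₁ i)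
        (fun i => j.u₂ i + Complex.I * j.v₂ i) := by
  -- At (0, 1, i) the centre drops out: X_s = (rw)', X_ss = (rw)'', while X_θ = -i r w, X_sθ = -i
  -- (rw)' and X_θθ = -r w. Hence X_sθ is parallel to X_s and X_θθ to X_θ, so only the X_ss term of
  -- the defect remains.
  have hI : Complex.I ^ 2 = -1 := Complex.I_sq
  have hT : j.derT 1 Complex.I = fun i => -Complex.I * j.r₀ * (j.u₀ i + Complex.I * j.v₀ i) := by
    funext i; simp only [derT]; linear_combination j.r₀ * j.v₀ i * hI
  have hST : j.derST 1 Complex.I = fun i => -Complex.I *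
      (j.r₁ * (j.u₀ i + Complex.I * j.v₀ i) + j.r₀ * (j.u₁ i + Complex.I * j.v₁ i)) := by
    funext i; simp only [derST]; linear_combination (j.r₁ * j.v₀ i + j.r₀ * j.v₁ i) * hI
  have hS : j.derS 0 1 Complex.I = fun i =>
      j.r₁ * (j.u₀ i + Complex.I * j.v₀ i) + j.r₀ * (j.u₁ i + Complex.I * j.v₁ i) := by
    funext i; simp only [derS]; ring
  have hSS : j.derSS 0 1 Complex.I = fun i =>
      j.r₂ * (j.u₀ i + Complex.I * j.v₀ i) + 2 * j.r₁ * (j.u₁ i + Complex.I * j.v₁ i)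
        + j.r₀ * (j.u₂ i + Complex.I * j.v₂ i) := by
    funext i; simp only [derSS]; ring
  have hTT : j.derTT 1 Complex.I = fun i => -j.r₀ * (j.u₀ i + Complex.I * j.v₀ i) := by
    funext i; simp only [derTT]; ring
  rw [defect, hT, hST, hS, hSS, hTT]
  generalize hw₀ : (fun i => j.u₀ i + Complex.I * j.v₀ i) = w₀
  generalize hw₁ : (fun i => j.u₁ i + Complex.I * j.v₁ i) = w₁
  generalize hw₂ : (fun i => j.u₂ i + Complex.I * j.v₂ i) = w₂
  have e₀ : ∀ i, j.u₀ i + Complex.I * j.v₀ i = w₀ i := fun i => congrFun hw₀ i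
  have e₁ : ∀ i, j.u₁ i + Complex.I * j.v₁ i = w₁ i := fun i => congrFun hw₁ i
  have e₂ : ∀ i, j.u₂ i + Complex.I * j.v₂ i = w₂ i := fun i => congrFun hw₂ i
  simp only [e₀, e₁, e₂, laplaceDefect, tripleDet]
  linear_combination (-Complex.I * j.r₀ ^ 5 * (w₀ 0 ^ 2 + w₀ 1 ^ 2) *
    ((w₀ 1 * w₁ 2 - w₀ 2 * w₁ 1) * w₂ 0 + (w₀ 2 * w₁ 0 - w₀ 0 * w₁ 2) * w₂ 1
      + (w₀ 0 * w₁ 1 - w₀ 1 * w₁ 0) * w₂ 2)) * (-1) * hI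

end CircleJet

/-- The product of two determinants is a Gram determinant. -/
theorem tripleDet_mul_tripleDet (p q a x y z : Fin 3 → K) :
    tripleDet p q a * tripleDet x y z =
      (p ⬝ᵥ x) * ((q ⬝ᵥ y) * (a ⬝ᵥ z) - (q ⬝ᵥ z) * (a ⬝ᵥ y))
      - (p ⬝ᵥ y) * ((q ⬝ᵥ x) * (a ⬝ᵥ z) - (q ⬝ᵥ z) * (a ⬝ᵥ x))
      + (p ⬝ᵥ z) * ((q ⬝ᵥ x) * (a ⬝ᵥ y) - (q ⬝ᵥ y) * (a ⬝ᵥ x)) := by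
  simp only [tripleDet, dotProduct, Fin.sum_univ_three]
  ring

/-- The determinant of the 2-jet of a curve of isotropic vectors vanishes only where the derivative
is isotropic. -/
theorem isotropic_of_tripleDet_eq_zero (w₀ w₁ w₂ : Fin 3 → ℂ) (h₀₀ : w₀ ⬝ᵥ w₀ = 0)
    (h₀₁ : w₀ ⬝ᵥ w₁ = 0) (h₀₂ : w₁ ⬝ᵥ w₁ + w₀ ⬝ᵥ w₂ = 0) (hdet : tripleDet w₀ w₁ w₂ = 0) :
    w₁ ⬝ᵥ w₁ = 0 := by
  -- With a = w₁·w₁ the Gram matrix has rows (0, 0, -a), (0, a, *), (-a, *, *), so its determinant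
  -- is -a³.
  have gram := tripleDet_mul_tripleDet w₀ w₁ w₂ w₀ w₁ w₂
  rw [dotProduct_comm w₂ w₀, dotProduct_comm w₁ w₀] at gram
  have h : w₀ ⬝ᵥ w₂ = -(w₁ ⬝ᵥ w₁) := by linear_combination h₀₂
  rw [hdet, h₀₀, h₀₁, h] at gram
  have : (w₁ ⬝ᵥ w₁) ^ 3 = 0 := by linear_combination gram
  exact pow_eq_zero_iff (three_ne_zero) |>.1 this

end Algebra

/-! ### Vanishing on the complexified circle, and its point at infinity -/

namespace CircleJet

/-- The conic is parametrized by τ, extending e^{iθ}; for |τ| = 1 the three arguments are 2τ·(1, C,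
S), so homogeneity applies. -/
theorem defect_map_ofReal (j : CircleJet ℝ) {C S : ℝ} (hCS : C ^ 2 + S ^ 2 = 1) {τ : ℂ}
    (hτ : τ = C + S * Complex.I) :
    (j.map Complex.ofRealHom).defect (2 * τ) (τ ^ 2 + 1) (-Complex.I * (τ ^ 2 - 1)) =
      (2 * τ) ^ 5 * (j.defect 1 C S : ℝ) := by
  have hCS' : (C : ℂ) ^ 2 + (S : ℂ) ^ 2 = 1 := by exact_mod_cast hCS
  have hI := Complex.I_sq
  have e1 : τ ^ 2 + 1 = 2 * τ * (C : ℂ) := by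
    rw [hτ]; linear_combination S ^ 2 * hI - hCS'
  have e2 : -Complex.I * (τ ^ 2 - 1) = 2 * τ * (S : ℂ) := by
    rw [hτ]; linear_combination (-2 * C * S - Complex.I * S ^ 2) * hI - Complex.I * hCS'
  have e := j.defect_map Complex.ofRealHom 1 C S
  rw [map_one] at e
  rw [e1, e2, ← Complex.ofRealHom_eq_coe (j.defect 1 C S), ← e, ← defect_mul, mul_one]
  rfl

/-- A trigonometric identity on an arc extends to the complexified circle. -/
theorem defect_complex_eq_zero (j : CircleJet ℝ) {θ₀ : ℝ}
    (h : ∀ᶠ θ in nhds θ₀, j.defect 1 (Real.cos θ) (Real.sin θ) = 0) (τ : ℂ) :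
    (j.map Complex.ofRealHom).defect (2 * τ) (τ ^ 2 + 1) (-Complex.I * (τ ^ 2 - 1)) = 0 := by
  set R : ℂ → ℂ := fun τ =>
    (j.map Complex.ofRealHom).defect (2 * τ) (τ ^ 2 + 1) (-Complex.I * (τ ^ 2 - 1)) with hR
  have hdiff : Differentiable ℂ R := by
    simp only [hR, defect, laplaceDefect, tripleDet, derS, derT, derSS, derST, derTT]
    fun_prop
  have han : AnalyticOnNhd ℂ R Set.univ := hdiff.differentiableOn.analyticOnNhd isOpen_univ
  have hder : HasDerivAt (fun θ : ℝ => Complex.exp (θ * Complex.I))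
      (Complex.exp (θ₀ * Complex.I) * Complex.I) θ₀ := by
    have := ((Complex.ofRealCLM.hasDerivAt (x := θ₀)).mul_const Complex.I).cexp
    simpa using this
  -- The zeros e^{iθ} accumulate at e^{iθ₀}, because θ ↦ e^{iθ} has nonzero derivative; the identity
  -- theorem then applies to the polynomial `R`.
  have hfreq : ∃ᶠ z in nhdsWithin (Complex.exp (θ₀ * Complex.I)) {Complex.exp (θ₀ * Complex.I)}ᶜ,
      R z = 0 := by
    have ht := hder.tendsto_nhdsNE (by simp)
    refine ht.frequently (Filter.Eventually.frequently ?_)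
    filter_upwards [nhdsWithin_le_nhds h] with θ hθ
    simp only [hR]
    rw [j.defect_map_ofReal (Real.cos_sq_add_sin_sq θ)
      (by rw [Complex.exp_mul_I, Complex.ofReal_cos, Complex.ofReal_sin]), hθ]
    simp
  exact han.eqOn_zero_of_preconnected_of_frequently_eq_zero isPreconnected_univ
    (Set.mem_univ _) hfreq (Set.mem_univ τ)

/-- The domain may contain only an arc of the circle; this gives the equation on the full circle, so
that antipodal points can be compared. -/
theorem defect_real_eq_zero (j : CircleJet ℝ) {θ₀ : ℝ}
    (h : ∀ᶠ θ in nhds θ₀, j.defect 1 (Real.cos θ) (Real.sin θ) = 0) {C S : ℝ}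
    (hCS : C ^ 2 + S ^ 2 = 1) : j.defect 1 C S = 0 := by
  have key := j.defect_complex_eq_zero h (C + S * Complex.I)
  rw [j.defect_map_ofReal hCS rfl] at key
  rcases mul_eq_zero.1 key with h0 | h0
  · have h1 := congrArg Complex.normSq
      ((mul_eq_zero.1 (pow_eq_zero_iff (by norm_num) |>.1 h0)).resolve_left two_ne_zero)
    rw [Complex.normSq_add_mul_I, hCS] at h1
    simp at h1
  · exact_mod_cast h0

/-- The plane of the circle is stationary to first order unless it is horizontal. -/
theorem tripleDet_eq_zero (j : CircleJet ℝ) (hr : j.r₀ ≠ 0)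
    (huu : j.u₀ ⬝ᵥ j.u₀ = 1) (hvv : j.v₀ ⬝ᵥ j.v₀ = 1) (huv : j.u₀ ⬝ᵥ j.v₀ = 0)
    (huu₁ : j.u₀ ⬝ᵥ j.u₁ = 0) (hvv₁ : j.v₀ ⬝ᵥ j.v₁ = 0)
    (huv₁ : j.u₁ ⬝ᵥ j.v₀ + j.u₀ ⬝ᵥ j.v₁ = 0)
    (huu₂ : j.u₁ ⬝ᵥ j.u₁ + j.u₀ ⬝ᵥ j.u₂ = 0) (hvv₂ : j.v₁ ⬝ᵥ j.v₁ + j.v₀ ⬝ᵥ j.v₂ = 0)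
    (huv₂ : j.u₂ ⬝ᵥ j.v₀ + 2 * (j.u₁ ⬝ᵥ j.v₁) + j.u₀ ⬝ᵥ j.v₂ = 0)
    (hne : ¬ (j.u₀ 2 = 0 ∧ j.v₀ 2 = 0)) {θ₀ : ℝ}
    (h : ∀ᶠ θ in nhds θ₀, j.defect 1 (Real.cos θ) (Real.sin θ) = 0) :
    tripleDet j.u₀ j.v₀ j.u₁ = 0 ∧ tripleDet j.u₀ j.v₀ j.v₁ = 0 := by
  have hI := Complex.I_sq
  -- The value τ = 0 is the point (0 : 1 : i).
  have key := j.defect_complex_eq_zero h 0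
  have e : (j.map Complex.ofRealHom).defect 0 1 Complex.I = 0 := by
    convert key using 1; congr 1 <;> simp
  rw [defect_zero_one_I] at e
  have c_uu := congrArg Complex.ofReal huu
  have c_vv := congrArg Complex.ofReal hvv
  have c_uv := congrArg Complex.ofReal huv
  have c_uu₁ := congrArg Complex.ofReal huu₁
  have c_vv₁ := congrArg Complex.ofReal hvv₁
  have c_uv₁ := congrArg Complex.ofReal huv₁
  have c_uu₂ := congrArg Complex.ofReal huu₂
  have c_vv₂ := congrArg Complex.ofReal hvv₂
  have c_uv₂ := congrArg Complex.ofReal huv₂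
  simp only [dotProduct, Fin.sum_univ_three] at c_uu c_vv c_uv c_uu₁ c_vv₁ c_uv₁ c_uu₂ c_vv₂ c_uv₂
  push_cast at c_uu c_vv c_uv c_uu₁ c_vv₁ c_uv₁ c_uu₂ c_vv₂ c_uv₂
  have hw₀ : ((j.u₀ 0 + Complex.I * j.v₀ 0) ^ 2 + (j.u₀ 1 + Complex.I * j.v₀ 1) ^ 2 : ℂ) =
      -(j.u₀ 2 + Complex.I * j.v₀ 2) ^ 2 := by
    linear_combination c_uu + Complex.I ^ 2 * c_vv + 2 * Complex.I * c_uv + hI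
  have hz : (j.u₀ 2 + Complex.I * j.v₀ 2 : ℂ) ≠ 0 := by
    intro h0
    refine hne ⟨?_, ?_⟩
    · simpa using congrArg Complex.re h0
    · simpa using congrArg Complex.im h0
  simp only [map, Function.comp_apply, Complex.ofRealHom_eq_coe] at e
  rw [hw₀] at e
  have hdet := (mul_eq_zero.1 e).resolve_left (by
    simp only [neg_mul, mul_neg, neg_neg]
    exact mul_ne_zero (mul_ne_zero Complex.I_ne_zero
      (pow_ne_zero _ (Complex.ofReal_ne_zero.2 hr))) (pow_ne_zero _ hz))
  have hiso := isotropic_of_tripleDet_eq_zero _ _ _ ?_ ?_ ?_ hdet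
  · simp only [dotProduct, Fin.sum_univ_three] at hiso
    have hre := congrArg Complex.re hiso
    have him := congrArg Complex.im hiso
    simp only [Complex.add_re, Complex.mul_re, Complex.add_im, Complex.mul_im, Complex.ofReal_re,
      Complex.ofReal_im, Complex.I_re, Complex.I_im, Complex.zero_re, Complex.zero_im] at hre him
    -- The determinants α, β are the components of u', v' along u × v. The tangential parts of u'
    -- and v' are orthogonal and of equal length, so |u'| = |v'| and u'·v' = 0 become α² = β² and αβ
    -- = 0.
    have hα := tripleDet_mul_tripleDet j.u₀ j.v₀ j.u₁ j.u₀ j.v₀ j.u₁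
    have hβ := tripleDet_mul_tripleDet j.u₀ j.v₀ j.v₁ j.u₀ j.v₀ j.v₁
    have hαβ := tripleDet_mul_tripleDet j.u₀ j.v₀ j.u₁ j.u₀ j.v₀ j.v₁
    generalize tripleDet j.u₀ j.v₀ j.u₁ = α at *
    generalize tripleDet j.u₀ j.v₀ j.v₁ = β at *
    rw [dotProduct_comm j.v₀ j.u₀, dotProduct_comm j.u₁ j.u₀, huu, hvv, huv, huu₁] at hα
    rw [dotProduct_comm j.v₀ j.u₀, dotProduct_comm j.v₁ j.v₀, huu, hvv, huv, hvv₁] at hβ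
    rw [dotProduct_comm j.v₀ j.u₀, dotProduct_comm j.u₁ j.u₀, huu, hvv, huv, huu₁, hvv₁] at hαβ
    rw [dotProduct_comm j.v₀ j.u₁] at hα
    rw [dotProduct_comm j.v₁ j.u₀] at hβ
    have hre' : j.u₁ ⬝ᵥ j.u₁ = j.v₁ ⬝ᵥ j.v₁ := by
      simp only [dotProduct, Fin.sum_univ_three]; linear_combination hre
    have him' : j.u₁ ⬝ᵥ j.v₁ = 0 := by
      simp only [dotProduct, Fin.sum_univ_three]; linear_combination him / 2
    have h1 : α ^ 2 = β ^ 2 := by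
      linear_combination hα - hβ + hre' - (j.u₁ ⬝ᵥ j.v₀ - j.u₀ ⬝ᵥ j.v₁) * huv₁
    have h2 : α * β = 0 := by linear_combination hαβ + him'
    rcases mul_eq_zero.1 h2 with b | b
    · exact ⟨b, by simpa [b] using h1.symm⟩
    · exact ⟨by simpa [b] using h1, b⟩
  · simp only [dotProduct, Fin.sum_univ_three]
    linear_combination c_uu + Complex.I ^ 2 * c_vv + 2 * Complex.I * c_uv + hI
  · simp only [dotProduct, Fin.sum_univ_three]
    linear_combination c_uu₁ + Complex.I ^ 2 * c_vv₁ + Complex.I * c_uv₁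
  · simp only [dotProduct, Fin.sum_univ_three]
    linear_combination c_uu₂ + Complex.I ^ 2 * c_vv₂ + Complex.I * c_uv₂

/-! ### Circles in parallel planes -/

theorem laplaceDefect_of_parallel (c₁ c₂ e f : Fin 3 → ℝ) (r₀ r₁ r₂ φ ψ : ℝ) :
    laplaceDefect (fun i => c₁ i + r₁ * e i + r₀ * φ * f i) (fun i => r₀ * f i)
      (fun i => c₂ i + r₂ * e i + 2 * r₁ * φ * f i + r₀ * (ψ * f i - φ ^ 2 * e i))
      (fun i => r₁ * f i - r₀ * φ * e i) (fun i => -r₀ * e i) =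
    r₀ ^ 2 * ((f 0 ^ 2 + f 1 ^ 2) * (r₀ * (tripleDet c₁ f c₂ + r₁ * tripleDet e f c₂
        - r₂ * tripleDet e f c₁))
      + tripleDet e f c₁ * ((c₁ 0 + r₁ * e 0) ^ 2 + (c₁ 1 + r₁ * e 1) ^ 2)) := by
  -- Here e and f are the radial and tangential directions. The terms in φ and ψ cancel, as they
  -- must: rotating the frame within its plane only shifts θ.
  simp only [laplaceDefect, tripleDet]
  ring

/-- The Laplace defect of a family of circles in planes that are parallel to second order. -/
theorem defect_of_parallel (j : CircleJet ℝ)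
    {φ ψ : ℝ} (hu₁ : ∀ i, j.u₁ i = φ * j.v₀ i) (hv₁ : ∀ i, j.v₁ i = -φ * j.u₀ i)
    (hu₂ : ∀ i, j.u₂ i = -φ ^ 2 * j.u₀ i + ψ * j.v₀ i)
    (hv₂ : ∀ i, j.v₂ i = -φ ^ 2 * j.v₀ i - ψ * j.u₀ i) {C S : ℝ} (hCS : C ^ 2 + S ^ 2 = 1)
    {e f : Fin 3 → ℝ} (he : e = fun i => C * j.u₀ i + S * j.v₀ i)
    (hf : f = fun i => -S * j.u₀ i + C * j.v₀ i) :
    j.defect 1 C S = j.r₀ ^ 2 * ((f 0 ^ 2 + f 1 ^ 2) *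
        (j.r₀ * (tripleDet j.c₁ f j.c₂ + j.r₁ * tripleDet j.u₀ j.v₀ j.c₂
          - j.r₂ * tripleDet j.u₀ j.v₀ j.c₁))
      + tripleDet j.u₀ j.v₀ j.c₁
        * ((j.c₁ 0 + j.r₁ * e 0) ^ 2 + (j.c₁ 1 + j.r₁ * e 1) ^ 2)) := by
  have hdet : ∀ x, tripleDet j.u₀ j.v₀ x = tripleDet e f x := by
    intro x
    have : tripleDet e f x = (C ^ 2 + S ^ 2) * tripleDet j.u₀ j.v₀ x := by
      simp only [he, hf, tripleDet]; ring
    rw [this, hCS, one_mul]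
  rw [hdet, hdet, ← laplaceDefect_of_parallel j.c₁ j.c₂ e f j.r₀ j.r₁ j.r₂ φ ψ, defect]
  congr 1 <;> funext i <;> simp only [derS, derT, derSS, derST, derTT, hu₁, hv₁, hu₂, hv₂, he, hf]
    <;> ring

/-- If the planes of a family of circles are parallel, to second order, and not horizontal, then
the Laplace equation forces the surface to be tangent to the planes, or to vertical lines. -/
theorem vertical_of_parallel (j : CircleJet ℝ) (hr : j.r₀ ≠ 0)
    (huu : j.u₀ ⬝ᵥ j.u₀ = 1) (hvv : j.v₀ ⬝ᵥ j.v₀ = 1) (huv : j.u₀ ⬝ᵥ j.v₀ = 0)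
    {φ ψ : ℝ} (hu₁ : ∀ i, j.u₁ i = φ * j.v₀ i) (hv₁ : ∀ i, j.v₁ i = -φ * j.u₀ i)
    (hu₂ : ∀ i, j.u₂ i = -φ ^ 2 * j.u₀ i + ψ * j.v₀ i)
    (hv₂ : ∀ i, j.v₂ i = -φ ^ 2 * j.v₀ i - ψ * j.u₀ i)
    (hne : ¬ (j.u₀ 2 = 0 ∧ j.v₀ 2 = 0)) (hη : tripleDet j.u₀ j.v₀ j.c₁ ≠ 0)
    (h : ∀ C S, C ^ 2 + S ^ 2 = 1 → j.defect 1 C S = 0) (C S : ℝ) :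
    j.derS 1 C S 0 * j.derT C S 1 - j.derS 1 C S 1 * j.derT C S 0 = 0 := by
  set η := tripleDet j.u₀ j.v₀ j.c₁ with hη_def
  set k := j.r₀ * (j.r₁ * tripleDet j.u₀ j.v₀ j.c₂ - j.r₂ * η) with hk
  set gc := j.c₁ 0 ^ 2 + j.c₁ 1 ^ 2 with hgc
  set guu := j.u₀ 0 ^ 2 + j.u₀ 1 ^ 2 with hguu
  set gvv := j.v₀ 0 ^ 2 + j.v₀ 1 ^ 2 with hgvv
  set guv := j.u₀ 0 * j.v₀ 0 + j.u₀ 1 * j.v₀ 1 with hguv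
  -- Averaging over antipodal points removes the odd terms: det(c', f, c'') and the product of c'
  -- with e.
  have even : ∀ C S, C ^ 2 + S ^ 2 = 1 →
      k * (S ^ 2 * guu + C ^ 2 * gvv - 2 * C * S * guv)
        + η * (gc + j.r₁ ^ 2 * (C ^ 2 * guu + S ^ 2 * gvv + 2 * C * S * guv)) = 0 := by
    intro C S hCS
    have h1 := h C S hCS
    have h2 := h (-C) (-S) (by linear_combination hCS)
    rw [j.defect_of_parallel hu₁ hv₁ hu₂ hv₂ hCS rfl rfl] at h1
    rw [j.defect_of_parallel hu₁ hv₁ hu₂ hv₂ (by linear_combination hCS) rfl rfl] at h2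
    have h1' := (mul_eq_zero.1 h1).resolve_left (pow_ne_zero 2 hr)
    have h2' := (mul_eq_zero.1 h2).resolve_left (pow_ne_zero 2 hr)
    rw [← hη_def] at h1' h2'
    have hodd : tripleDet j.c₁ (fun i => - -S * j.u₀ i + -C * j.v₀ i) j.c₂ =
        -tripleDet j.c₁ (fun i => -S * j.u₀ i + C * j.v₀ i) j.c₂ := by
      simp only [tripleDet]; ring
    rw [hodd] at h2'
    rw [hk, hgc, hguu, hgvv, hguv]
    linear_combination (h1' + h2') / 2
  -- Three points determine a quadratic form on the circle; (3/5, 4/5) is a rational point with CS ≠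
  -- 0.
  have a1 := even 1 0 (by norm_num)
  have a2 := even 0 1 (by norm_num)
  have a3 := even (3 / 5) (4 / 5) (by norm_num)
  simp only [dotProduct, Fin.sum_univ_three] at huu hvv huv
  have d1 : (guu - gvv) * (k - η * j.r₁ ^ 2) = 0 := by linear_combination a2 - a1
  have d2 : guv * (k - η * j.r₁ ^ 2) = 0 := by
    linear_combination (-25 / 24) * a3 + 9 / 24 * a1 + 16 / 24 * a2
  -- Otherwise the vertical projection of the plane would be conformal, which happens only for a
  -- horizontal plane.
  have hk' : k - η * j.r₁ ^ 2 = 0 := by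
    by_contra hk0
    have b1 := (mul_eq_zero.1 d1).resolve_right hk0
    have b2 := (mul_eq_zero.1 d2).resolve_right hk0
    have b3 : j.u₀ 2 * j.v₀ 2 = 0 := by linear_combination huv - b2
    have b4 : j.u₀ 2 ^ 2 = j.v₀ 2 ^ 2 := by linear_combination huu - hvv - b1
    rcases mul_eq_zero.1 b3 with b | b
    · exact hne ⟨b, by simpa [b] using b4.symm⟩
    · exact hne ⟨by simpa [b] using b4, b⟩
  have hsum : gc + j.r₁ ^ 2 * (guu + gvv) = 0 := by
    have : η * (gc + j.r₁ ^ 2 * (guu + gvv)) = 0 := by linear_combination a1 - gvv * hk'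
    exact (mul_eq_zero.1 this).resolve_left hη
  have hpos : 0 < guu + gvv := by
    by_contra hn
    have p1 : guu = 0 := by linarith [show 0 ≤ guu by positivity, show 0 ≤ gvv by positivity]
    have p2 : gvv = 0 := by linarith [show 0 ≤ guu by positivity, show 0 ≤ gvv by positivity]
    have p3 : guv ^ 2 = 0 := by
      have : guv ^ 2 = guu * gvv - (j.u₀ 0 * j.v₀ 1 - j.u₀ 1 * j.v₀ 0) ^ 2 := by
        rw [hguv, hguu, hgvv]; ring
      rw [p1, p2] at this
      exact le_antisymm (by linarith [sq_nonneg (j.u₀ 0 * j.v₀ 1 - j.u₀ 1 * j.v₀ 0)])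
        (sq_nonneg _)
    have p4 : guv = 0 := by simpa using p3
    have q1 : j.u₀ 2 ^ 2 = 1 := by linear_combination huu - p1
    have q2 : j.v₀ 2 ^ 2 = 1 := by linear_combination hvv - p2
    have q3 : j.u₀ 2 * j.v₀ 2 = 0 := by linear_combination huv - p4
    have : (j.u₀ 2 * j.v₀ 2) ^ 2 = 1 := by rw [mul_pow, q1, q2, one_mul]
    rw [q3] at this; norm_num at this
  have hgc0 : 0 ≤ gc := by positivity
  have hr₁ : j.r₁ = 0 := by
    have : j.r₁ ^ 2 * (guu + gvv) = 0 :=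
      le_antisymm (by linarith) (mul_nonneg (sq_nonneg _) hpos.le)
    simpa using (mul_eq_zero.1 this).resolve_right hpos.ne'
  have hgc1 : gc = 0 := by rw [hr₁] at hsum; linarith
  obtain ⟨hc0, hc1⟩ := (add_eq_zero_iff_of_nonneg (sq_nonneg _) (sq_nonneg _)).1 hgc1
  rw [sq_eq_zero_iff] at hc0 hc1
  -- With r' = 0 and c' vertical, the horizontal part of X_s is φ times that of X_θ.
  simp only [derS, derT, hu₁, hv₁, hr₁, hc0, hc1]
  ring

end CircleJet

/-! ### The Euler-Lagrange equation of the Dirichlet energy -/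

section Geometry

theorem inner_eq_sum_three (x y : E3) : inner ℝ x y = x 0 * y 0 + x 1 * y 1 + x 2 * y 2 := by
  simp only [PiLp.inner_apply, Fin.sum_univ_three, RCLike.inner_apply, conj_trivial]
  ring

theorem cross_apply_zero (x y : E3) : cross x y 0 = x 1 * y 2 - x 2 * y 1 := by
  simp [cross, crossProduct]

theorem cross_apply_one (x y : E3) : cross x y 1 = x 2 * y 0 - x 0 * y 2 := by
  simp [cross, crossProduct]

theorem cross_apply_two (x y : E3) : cross x y 2 = x 0 * y 1 - x 1 * y 0 := by
  simp [cross, crossProduct]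

theorem inner_cross_left (x y z : E3) : inner ℝ (cross x y) z = tripleDet x y z := by
  rw [inner_eq_sum_three, cross_apply_zero, cross_apply_one, cross_apply_two, tripleDet]

theorem differentiableAt_cross {p q : ℝ → E3} {t : ℝ} (hp : DifferentiableAt ℝ p t)
    (hq : DifferentiableAt ℝ q t) : DifferentiableAt ℝ (fun t => cross (p t) (q t)) t := by
  have hp' := differentiableAt_euclidean.1 hp
  have hq' := differentiableAt_euclidean.1 hq
  refine differentiableAt_euclidean.2 fun i => ?_
  fin_cases i
  · simp only [Fin.zero_eta, cross_apply_zero]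
    exact ((hp' 1).mul (hq' 2)).sub ((hp' 2).mul (hq' 1))
  · simp only [Fin.mk_one, cross_apply_one]
    exact ((hp' 2).mul (hq' 0)).sub ((hp' 0).mul (hq' 2))
  · simp only [Fin.reduceFinMk, cross_apply_two]
    exact ((hp' 0).mul (hq' 1)).sub ((hp' 1).mul (hq' 0))

theorem hasDerivAt_inner_eq_zero {f g : ℝ → E3} {f' g' : E3} {t k : ℝ} (hf : HasDerivAt f f' t)
    (hg : HasDerivAt g g' t) (h : ∀ᶠ s in nhds t, inner ℝ (f s) (g s) = k) :
    inner ℝ f' (g t) + inner ℝ (f t) g' = 0 := by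
  have h1 := hf.inner ℝ hg
  have h2 : HasDerivAt (fun s => inner ℝ (f s) (g s)) (0 : ℝ) t :=
    (hasDerivAt_const t k).congr_of_eventuallyEq h
  linarith [h1.unique h2]

/-- The derivative of the unit normal along a curve (Weingarten equations). -/
theorem exists_hasDerivAt_unit_cross {p q : ℝ → E3} {p' q' : E3} {t : ℝ}
    (hp : HasDerivAt p p' t) (hq : HasDerivAt q q' t) (hne : cross (p t) (q t) ≠ 0)
    {ν : ℝ → E3} (hν : ν = fun t => ‖cross (p t) (q t)‖⁻¹ • cross (p t) (q t)) :
    ∃ ν' : E3, HasDerivAt ν ν' t ∧ inner ℝ ν' (ν t) = 0 ∧ inner ℝ ν' (p t) = -inner ℝ (ν t) p' ∧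
      inner ℝ ν' (q t) = -inner ℝ (ν t) q' := by
  have hN := differentiableAt_cross hp.differentiableAt hq.differentiableAt
  have hd : DifferentiableAt ℝ ν t := by
    rw [hν]
    exact ((hN.norm ℝ hne).inv (norm_ne_zero_iff.2 hne)).smul hN
  have h1 : ∀ᶠ s in nhds t, inner ℝ (ν s) (ν s) = (1 : ℝ) := by
    filter_upwards [hN.continuousAt.eventually_ne hne] with s hs
    rw [hν, real_inner_self_eq_norm_sq, norm_smul, norm_inv, norm_norm,
      inv_mul_cancel₀ (norm_ne_zero_iff.2 hs), one_pow]
  have h2 : ∀ s, inner ℝ (ν s) (p s) = (0 : ℝ) := fun s => by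
    rw [hν, real_inner_smul_left, inner_cross_left, tripleDet]; ring
  have h3 : ∀ s, inner ℝ (ν s) (q s) = (0 : ℝ) := fun s => by
    rw [hν, real_inner_smul_left, inner_cross_left, tripleDet]; ring
  have e1 := hasDerivAt_inner_eq_zero hd.hasDerivAt hd.hasDerivAt h1
  have e2 := hasDerivAt_inner_eq_zero hd.hasDerivAt hp (Filter.Eventually.of_forall h2)
  have e3 := hasDerivAt_inner_eq_zero hd.hasDerivAt hq (Filter.Eventually.of_forall h3)
  rw [real_inner_comm (deriv ν t) (ν t)] at e1
  exact ⟨_, hd.hasDerivAt, by linarith, by linarith, by linarith⟩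

/-- The vertical unit vector. -/
noncomputable def vert : E3 := EuclideanSpace.single 2 1

theorem inner_vert_left (x : E3) : inner ℝ vert x = x 2 := by
  simp [vert, inner_eq_sum_three]

theorem hasGradientAt_dirichletDensity {ν : E3} (h : ν 2 ≠ 0) :
    HasGradientAt dirichletDensity ((-((ν 2) ^ 2)⁻¹ - 1) • vert) ν := by
  have h0 : HasFDerivAt (fun x : E3 => x 2) (InnerProductSpace.toDual ℝ E3 vert) ν := by
    have : (fun x : E3 => x 2) = InnerProductSpace.toDual ℝ E3 vert := by
      funext x; rw [InnerProductSpace.toDual_apply_apply, inner_vert_left]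
    rw [this]
    exact ContinuousLinearMap.hasFDerivAt _
  have h1 : HasDerivAt (fun y : ℝ => 1 / y - y) (-((ν 2) ^ 2)⁻¹ - 1) (ν 2) := by
    have := (hasDerivAt_inv h).sub (hasDerivAt_id' (ν 2))
    simp only [one_div]
    exact this
  rw [hasGradientAt_iff_hasFDerivAt, map_smul]
  exact h1.comp_hasFDerivAt ν h0

theorem sphereGradient_dirichletDensity {ν : E3} (h : ν 2 ≠ 0) :
    sphereGradient dirichletDensity ν = (-((ν 2) ^ 2)⁻¹ - 1) • (vert - ν 2 • ν) := by
  rw [sphereGradient, (hasGradientAt_dirichletDensity h).gradient, real_inner_smul_left,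
    inner_vert_left, smul_sub, smul_smul]

/-- The field is g(ν₃)(e₃ - ν₃ν) with g(y) = -1/y² - 1. Against a tangent vector every term along ν
disappears, leaving g'(ν₃)ν₃' e₃ and -g(ν₃)ν₃ν'. -/
theorem exists_hasDerivAt_sphereGradient {ν : ℝ → E3} {ν' : E3} {t : ℝ} (hν : HasDerivAt ν ν' t)
    (h : ν t 2 ≠ 0) :
    ∃ V' : E3, HasDerivAt (fun s => sphereGradient dirichletDensity (ν s)) V' t ∧
      ∀ x, inner ℝ (ν t) x = (0 : ℝ) → inner ℝ V' x =
        2 / ν t 2 ^ 3 * ν' 2 * x 2 + (1 / ν t 2 + ν t 2) * inner ℝ ν' x := by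
  have h2 : HasDerivAt (fun s => ν s 2) (ν' 2) t := by
    have := (hasDerivAt_const t vert).inner ℝ hν
    simpa [inner_vert_left] using this
  have hg := ((h2.pow 2).inv (pow_ne_zero 2 h)).neg.sub_const 1
  have hV := hg.smul ((hasDerivAt_const t vert).sub (h2.smul hν))
  refine ⟨_, hV.congr_of_eventuallyEq ?_, ?_⟩
  · filter_upwards [h2.continuousAt.eventually_ne h] with s hs
    rw [sphereGradient_dirichletDensity hs]
    rfl
  · intro x hx
    simp only [inner_add_left, inner_sub_left, real_inner_smul_left, inner_vert_left, hx,
      inner_zero_left, Pi.smul_apply', Pi.sub_apply, Pi.neg_apply, Pi.inv_apply, Pi.pow_apply]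
    field_simp
    ring

theorem inner_self_cross (p q : E3) : inner ℝ (cross p q) (cross p q) =
    inner ℝ p p * inner ℝ q q - inner ℝ p q ^ 2 := by
  simp only [inner_eq_sum_three, cross_apply_zero, cross_apply_one, cross_apply_two]
  ring

/-- The height of a vector orthogonal to `p × q`, from its inner products with `p` and `q`. -/
theorem height_of_orthogonal {p q a : E3} (h : inner ℝ a (cross p q) = (0 : ℝ)) :
    (inner ℝ p p * inner ℝ q q - inner ℝ p q ^ 2) * a 2 =
      p 2 * (inner ℝ q q * inner ℝ a p - inner ℝ p q * inner ℝ a q)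
        + q 2 * (inner ℝ p p * inner ℝ a q - inner ℝ p q * inner ℝ a p) := by
  simp only [inner_eq_sum_three, cross_apply_zero, cross_apply_one, cross_apply_two] at h ⊢
  linear_combination (p 0 * q 1 - p 1 * q 0) * h

/-- A surface whose anisotropic mean curvature for the Dirichlet energy vanishes satisfies the
Laplace equation. -/
theorem laplaceDefect_eq_zero {X : ℝ → ℝ → E3} {s θ : ℝ} {a b d : E3}
    (ha : HasDerivAt (fun t => partialS X t θ) a s) (hb : HasDerivAt (fun t => partialS X s t) b θ)
    (hb' : HasDerivAt (fun t => partialT X t θ) b s)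
    (hd : HasDerivAt (fun t => partialT X s t) d θ) (hN : normalVec X s θ ≠ 0)
    (hν : unitNormal X s θ 2 ≠ 0) (hΛ : anisotropicMeanCurvature dirichletDensity X s θ = 0) :
    laplaceDefect (partialS X s θ) (partialT X s θ) a b d = 0 := by
  obtain ⟨νs, hνs, s1, s2, s3⟩ := exists_hasDerivAt_unit_cross ha hb' hN
    (ν := fun t => unitNormal X t θ) rfl
  obtain ⟨νt, hνt, t1, t2, t3⟩ := exists_hasDerivAt_unit_cross hb hd hN
    (ν := fun t => unitNormal X s t) rfl
  obtain ⟨Vs, hVs, hVs'⟩ := exists_hasDerivAt_sphereGradient hνs hν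
  obtain ⟨Vt, hVt, hVt'⟩ := exists_hasDerivAt_sphereGradient hνt hν
  have hνp : inner ℝ (unitNormal X s θ) (partialS X s θ) = (0 : ℝ) := by
    rw [unitNormal, normalVec, real_inner_smul_left, inner_cross_left, tripleDet]; ring
  have hνq : inner ℝ (unitNormal X s θ) (partialT X s θ) = (0 : ℝ) := by
    rw [unitNormal, normalVec, real_inner_smul_left, inner_cross_left, tripleDet]; ring
  have dss : partialS (partialS X) s θ = a := ha.deriv
  have dst : partialT (partialS X) s θ = b := hb.deriv
  have dts : partialS (partialT X) s θ = b := hb'.deriv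
  have dtt : partialT (partialT X) s θ = d := hd.deriv
  have dVs : partialS (fun s' θ' => sphereGradient dirichletDensity (unitNormal X s' θ')) s θ = Vs :=
    hVs.deriv
  have dVt : partialT (fun s' θ' => sphereGradient dirichletDensity (unitNormal X s' θ')) s θ = Vt :=
    hVt.deriv
  simp only [anisotropicMeanCurvature, meanCurvature, surfaceDiv, metricTrace, dss, dst, dts, dtt,
    dVs, dVt, hVs' _ hνp, hVs' _ hνq, hVt' _ hνp, hVt' _ hνq, s2, s3, t2, t3,
    dirichletDensity] at hΛ
  set p := partialS X s θ
  set q := partialT X s θ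
  have hnpos : ‖cross p q‖ ≠ 0 := norm_ne_zero_iff.2 hN
  have hNν : cross p q = ‖cross p q‖ • unitNormal X s θ := by
    change cross p q = ‖cross p q‖ • (‖cross p q‖⁻¹ • cross p q)
    rw [smul_smul, mul_inv_cancel₀ hnpos, one_smul]
  have hΔ := inner_self_cross p q
  rw [real_inner_self_eq_norm_sq] at hΔ
  have hs := height_of_orthogonal (p := p) (q := q) (a := νs) (by
    rw [hNν, real_inner_smul_right, s1, mul_zero])
  have ht := height_of_orthogonal (p := p) (q := q) (a := νt) (by
    rw [hNν, real_inner_smul_right, t1, mul_zero])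
  rw [s2, s3] at hs
  rw [t2, t3] at ht
  have hN2 : cross p q 2 = ‖cross p q‖ * unitNormal X s θ 2 := by
    conv_lhs => rw [hNν]
    simp
  have ta : tripleDet p q a = ‖cross p q‖ * inner ℝ (unitNormal X s θ) a := by
    rw [← inner_cross_left, ← real_inner_smul_left, ← hNν]
  have tb : tripleDet p q b = ‖cross p q‖ * inner ℝ (unitNormal X s θ) b := by
    rw [← inner_cross_left, ← real_inner_smul_left, ← hNν]
  have td : tripleDet p q d = ‖cross p q‖ * inner ℝ (unitNormal X s θ) d := by
    rw [← inner_cross_left, ← real_inner_smul_left, ← hNν]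
  have hN3 : (inner ℝ p p * inner ℝ q q - inner ℝ p q ^ 2) * unitNormal X s θ 2 ^ 2 =
      (q 0 ^ 2 + q 1 ^ 2) * (p 0 ^ 2 + p 1 ^ 2) - (p 0 * q 0 + p 1 * q 1) ^ 2 := by
    rw [← hΔ, ← mul_pow, ← hN2, cross_apply_two]; ring
  rw [laplaceDefect, ta, tb, td]
  have eE : p 0 ^ 2 + p 1 ^ 2 = inner ℝ p p - p 2 ^ 2 := by rw [inner_eq_sum_three]; ring
  have eF : p 0 * q 0 + p 1 * q 1 = inner ℝ p q - p 2 * q 2 := by rw [inner_eq_sum_three]; ring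
  have eG : q 0 ^ 2 + q 1 ^ 2 = inner ℝ q q - q 2 ^ 2 := by rw [inner_eq_sum_three]; ring
  rw [eE, eF, eG] at hN3 ⊢
  have hΔ0 : (inner ℝ p p * inner ℝ q q - inner ℝ p q ^ 2 : ℝ) ≠ 0 := by
    rw [← hΔ]; exact pow_ne_zero 2 hnpos
  generalize ‖cross p q‖ = n at *
  generalize unitNormal X s θ 2 = ν₃ at *
  generalize inner ℝ (unitNormal X s θ) a = h₁₁ at *
  generalize inner ℝ (unitNormal X s θ) b = h₁₂ at *
  generalize inner ℝ (unitNormal X s θ) d = h₂₂ at *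
  generalize (inner ℝ p p : ℝ) = E at *
  generalize (inner ℝ p q : ℝ) = F at *
  generalize (inner ℝ q q : ℝ) = G at *
  generalize νs 2 = α at *
  generalize νt 2 = β at *
  generalize p 2 = x at *
  generalize q 2 = y at *
  clear * - hΛ hs ht hN3 hν hΔ0
  -- The contributions ±ν₃ tr h of 2HF(ν) and of the divergence cancel, and those in 1/ν₃ add up.
  have hΛ' : (G * h₁₁ - 2 * F * h₁₂ + E * h₂₂) * ν₃ ^ 2
      - (α * (G * x - F * y) + β * (E * y - F * x)) = 0 := by
    rw [mul_comm E G] at hΔ0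
    field_simp at hΛ
    linear_combination hΛ / 2
  -- The Weingarten equations eliminate the heights α, β of ν_s, ν_θ, and (EG - F²)ν₃² is the Gram
  -- determinant of the horizontal parts of X_s, X_θ.
  have : (E * G - F ^ 2) * ((G - y ^ 2) * h₁₁ - 2 * (F - x * y) * h₁₂ + (E - x ^ 2) * h₂₂) = 0 := by
    linear_combination (E * G - F ^ 2) * hΛ' + (G * x - F * y) * hs + (E * y - F * x) * ht
      - (G * h₁₁ - 2 * F * h₁₂ + E * h₂₂) * hN3
  have := (mul_eq_zero.1 this).resolve_left hΔ0
  linear_combination n * this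

end Geometry

/-! ### Families of circles -/

theorem inner_eq_dotProduct (x y : E3) : inner ℝ x y = x.ofLp ⬝ᵥ y.ofLp := by
  rw [inner_eq_sum_three, dotProduct, Fin.sum_univ_three]

/-- A vector of the plane of two orthonormal vectors, in coordinates. -/
theorem eq_of_tripleDet_eq_zero {u v x : E3} (hu : inner ℝ u u = (1 : ℝ))
    (hv : inner ℝ v v = (1 : ℝ)) (huv : inner ℝ u v = (0 : ℝ)) (h : tripleDet u v x = 0) :
    x = (inner ℝ u x : ℝ) • u + (inner ℝ v x : ℝ) • v := by
  -- By Gram, the squared determinant is the squared distance from x to span{u, v}.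
  have g := tripleDet_mul_tripleDet u v x u v x
  simp only [← inner_eq_dotProduct] at g
  rw [h, real_inner_comm u v, real_inner_comm u x, real_inner_comm v x, hu, hv, huv] at g
  rw [← sub_eq_zero, ← inner_self_eq_zero (𝕜 := ℝ)]
  simp only [inner_sub_left, inner_sub_right, inner_add_left, inner_add_right,
    real_inner_smul_left, real_inner_smul_right, real_inner_comm u v, real_inner_comm u x,
    real_inner_comm v x, hu, hv, huv]
  linear_combination -g

theorem hasDerivAt_coord {f : ℝ → E3} {f' : E3} {t : ℝ} (hf : HasDerivAt f f' t) (i : Fin 3) :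
    HasDerivAt (fun t => f t i) (f' i) t :=
  (EuclideanSpace.proj (𝕜 := ℝ) i).hasFDerivAt.comp_hasDerivAt t hf

theorem hasDerivAt_cross {p q : ℝ → E3} {p' q' : E3} {t : ℝ} (hp : HasDerivAt p p' t)
    (hq : HasDerivAt q q' t) :
    HasDerivAt (fun t => cross (p t) (q t)) (cross p' (q t) + cross (p t) q') t := by
  have hd := (differentiableAt_cross hp.differentiableAt hq.differentiableAt).hasDerivAt
  refine hd.congr_deriv (PiLp.ext fun i => ?_)
  have e := hasDerivAt_coord hd i
  have hp' := hasDerivAt_coord hp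
  have hq' := hasDerivAt_coord hq
  fin_cases i
  · simp only [Fin.zero_eta, cross_apply_zero, PiLp.add_apply] at e ⊢
    exact e.unique ((((hp' 1).mul (hq' 2)).sub ((hp' 2).mul (hq' 1))).congr_deriv (by ring))
  · simp only [Fin.mk_one, cross_apply_one, PiLp.add_apply] at e ⊢
    exact e.unique ((((hp' 2).mul (hq' 0)).sub ((hp' 0).mul (hq' 2))).congr_deriv (by ring))
  · simp only [Fin.reduceFinMk, cross_apply_two, PiLp.add_apply] at e ⊢
    exact e.unique ((((hp' 0).mul (hq' 1)).sub ((hp' 1).mul (hq' 0))).congr_deriv (by ring))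

theorem hasDerivAt_of_contDiffOn {F : Type*} [NormedAddCommGroup F] [NormedSpace ℝ F] {f : ℝ → F}
    {I : Set ℝ} (hI : IsOpen I) (hf : ContDiffOn ℝ ∞ f I) {s : ℝ} (hs : s ∈ I) :
    HasDerivAt f (deriv f s) s ∧ HasDerivAt (deriv f) (deriv (deriv f) s) s := by
  have h := (contDiffOn_infty_iff_deriv_of_isOpen hI).1 hf
  exact ⟨((h.1 s hs).differentiableAt (hI.mem_nhds hs)).hasDerivAt,
    ((h.2.differentiableOn (by simp) s hs).differentiableAt (hI.mem_nhds hs)).hasDerivAt⟩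

namespace CircleFamily

variable (C : CircleFamily)

/-- The 2-jet of the family at the parameter `s`. -/
noncomputable def jet (s : ℝ) : CircleJet ℝ where
  c₁ := (deriv C.c s).ofLp
  c₂ := (deriv (deriv C.c) s).ofLp
  u₀ := (C.u s).ofLp
  u₁ := (deriv C.u s).ofLp
  u₂ := (deriv (deriv C.u) s).ofLp
  v₀ := (C.v s).ofLp
  v₁ := (deriv C.v s).ofLp
  v₂ := (deriv (deriv C.v) s).ofLp
  r₀ := C.r s
  r₁ := deriv C.r s
  r₂ := deriv (deriv C.r) s

theorem hasDerivAt_combination {a b : ℝ} {u v : ℝ → E3} {u' v' : E3} {s : ℝ}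
    (hu : HasDerivAt u u' s) (hv : HasDerivAt v v' s) :
    HasDerivAt (fun t => a • u t + b • v t) (a • u' + b • v') s :=
  (hu.const_smul a).add (hv.const_smul b)

variable {C}

theorem partialS_param {s : ℝ} (hs : s ∈ C.I) (θ : ℝ) :
    partialS C.param s θ = deriv C.c s +
      (C.r s • (Real.cos θ • deriv C.u s + Real.sin θ • deriv C.v s)
        + deriv C.r s • (Real.cos θ • C.u s + Real.sin θ • C.v s)) := by
  have hc := (hasDerivAt_of_contDiffOn C.isOpen_I C.smooth_c hs).1
  have hr := (hasDerivAt_of_contDiffOn C.isOpen_I C.smooth_r hs).1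
  have hu := (hasDerivAt_of_contDiffOn C.isOpen_I C.smooth_u hs).1
  have hv := (hasDerivAt_of_contDiffOn C.isOpen_I C.smooth_v hs).1
  exact (hc.add (hr.smul (hasDerivAt_combination hu hv))).deriv

theorem hasDerivAt_circle (x y : E3) (θ : ℝ) :
    HasDerivAt (fun t => Real.cos t • x + Real.sin t • y)
      (-Real.sin θ • x + Real.cos θ • y) θ :=
  ((Real.hasDerivAt_cos θ).smul_const x).add ((Real.hasDerivAt_sin θ).smul_const y)

theorem hasDerivAt_circle_tangent (x y : E3) (θ : ℝ) :
    HasDerivAt (fun t => -Real.sin t • x + Real.cos t • y)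
      (-Real.cos θ • x + -Real.sin θ • y) θ :=
  ((Real.hasDerivAt_sin θ).neg.smul_const x).add ((Real.hasDerivAt_cos θ).smul_const y)

theorem partialT_param (s θ : ℝ) :
    partialT C.param s θ = C.r s • (-Real.sin θ • C.u s + Real.cos θ • C.v s) :=
  (((hasDerivAt_circle _ _ θ).const_smul (C.r s)).const_add (C.c s)).deriv

theorem partialS_param_eq_derS {s : ℝ} (hs : s ∈ C.I) (θ : ℝ) :
    (partialS C.param s θ).ofLp = (C.jet s).derS 1 (Real.cos θ) (Real.sin θ) := by
  rw [partialS_param hs]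
  funext i
  simp only [CircleJet.derS, jet, PiLp.add_apply, PiLp.smul_apply, smul_eq_mul]
  ring

theorem partialT_param_eq_derT (s θ : ℝ) :
    (partialT C.param s θ).ofLp = (C.jet s).derT (Real.cos θ) (Real.sin θ) := by
  rw [partialT_param]
  funext i
  simp only [CircleJet.derT, jet, PiLp.add_apply, PiLp.smul_apply, smul_eq_mul]

theorem defect_jet_eq_zero {U : Set (ℝ × ℝ)} (hU : C.IsDomain U)
    (hmin : IsDirichletMinimalOn C.param U) {s θ : ℝ} (h : (s, θ) ∈ U) :
    (C.jet s).defect 1 (Real.cos θ) (Real.sin θ) = 0 := by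
  have hs : s ∈ C.I := hU.2.1 _ h
  obtain ⟨hN, hν, hΛ⟩ := hmin _ h
  have hc := (hasDerivAt_of_contDiffOn C.isOpen_I C.smooth_c hs).2
  have hr := hasDerivAt_of_contDiffOn C.isOpen_I C.smooth_r hs
  have hu := hasDerivAt_of_contDiffOn C.isOpen_I C.smooth_u hs
  have hv := hasDerivAt_of_contDiffOn C.isOpen_I C.smooth_v hs
  have ha := (hc.add ((hr.1.smul (hasDerivAt_combination (a := Real.cos θ) (b := Real.sin θ)
    hu.2 hv.2)).add (hr.2.smul (hasDerivAt_combination (a := Real.cos θ) (b := Real.sin θ)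
    hu.1 hv.1)))).congr_of_eventuallyEq
      (f₁ := fun t => partialS C.param t θ) (by
        filter_upwards [C.isOpen_I.mem_nhds hs] with t ht using partialS_param ht θ)
  have hb := ((((hasDerivAt_circle (deriv C.u s) (deriv C.v s) θ).const_smul (C.r s)).add
    ((hasDerivAt_circle (C.u s) (C.v s) θ).const_smul (deriv C.r s))).const_add
      (deriv C.c s)).congr_of_eventuallyEq
      (f₁ := fun t => partialS C.param s t) (Filter.Eventually.of_forall (partialS_param hs))
  have hb' := (hr.1.smul (hasDerivAt_combination (a := -Real.sin θ) (b := Real.cos θ)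
    hu.1 hv.1)).congr_of_eventuallyEq
      (f₁ := fun t => partialT C.param t θ)
      (Filter.Eventually.of_forall fun t => partialT_param t θ)
  have hd := ((hasDerivAt_circle_tangent (C.u s) (C.v s) θ).const_smul
    (C.r s)).congr_of_eventuallyEq
      (f₁ := fun t => partialT C.param s t)
      (Filter.Eventually.of_forall fun t => partialT_param s t)
  have key := laplaceDefect_eq_zero ha hb hb' hd hN hν hΛ
  rw [partialS_param_eq_derS hs, partialT_param_eq_derT] at key
  rw [CircleJet.defect, ← key]
  congr 1 <;> funext i <;>
    simp only [CircleJet.derSS, CircleJet.derST, CircleJet.derTT, jet, PiLp.add_apply,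
      PiLp.smul_apply, smul_eq_mul] <;> ring

theorem inner_u_u {s : ℝ} (hs : s ∈ C.I) : inner ℝ (C.u s) (C.u s) = (1 : ℝ) := by
  rw [real_inner_self_eq_norm_sq, C.norm_u s hs, one_pow]

theorem inner_v_v {s : ℝ} (hs : s ∈ C.I) : inner ℝ (C.v s) (C.v s) = (1 : ℝ) := by
  rw [real_inner_self_eq_norm_sq, C.norm_v s hs, one_pow]

theorem inner_u_deriv_u {s : ℝ} (hs : s ∈ C.I) : inner ℝ (C.u s) (deriv C.u s) = (0 : ℝ) := by
  have hu := (hasDerivAt_of_contDiffOn C.isOpen_I C.smooth_u hs).1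
  have := hasDerivAt_inner_eq_zero hu hu (k := 1) (by
    filter_upwards [C.isOpen_I.mem_nhds hs] with t ht using inner_u_u ht)
  rw [real_inner_comm] at this
  linarith

theorem inner_v_deriv_v {s : ℝ} (hs : s ∈ C.I) : inner ℝ (C.v s) (deriv C.v s) = (0 : ℝ) := by
  have hv := (hasDerivAt_of_contDiffOn C.isOpen_I C.smooth_v hs).1
  have := hasDerivAt_inner_eq_zero hv hv (k := 1) (by
    filter_upwards [C.isOpen_I.mem_nhds hs] with t ht using inner_v_v ht)
  rw [real_inner_comm] at this
  linarith

theorem inner_deriv_u_v {s : ℝ} (hs : s ∈ C.I) :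
    inner ℝ (deriv C.u s) (C.v s) + inner ℝ (C.u s) (deriv C.v s) = (0 : ℝ) :=
  hasDerivAt_inner_eq_zero (hasDerivAt_of_contDiffOn C.isOpen_I C.smooth_u hs).1
    (hasDerivAt_of_contDiffOn C.isOpen_I C.smooth_v hs).1 (k := 0) (by
    filter_upwards [C.isOpen_I.mem_nhds hs] with t ht using C.inner_u_v t ht)

theorem inner_u_deriv_deriv_u {s : ℝ} (hs : s ∈ C.I) :
    inner ℝ (deriv C.u s) (deriv C.u s) + inner ℝ (C.u s) (deriv (deriv C.u) s) = (0 : ℝ) := by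
  have hu := hasDerivAt_of_contDiffOn C.isOpen_I C.smooth_u hs
  exact hasDerivAt_inner_eq_zero hu.1 hu.2 (k := 0) (by
    filter_upwards [C.isOpen_I.mem_nhds hs] with t ht using inner_u_deriv_u ht)

theorem inner_v_deriv_deriv_v {s : ℝ} (hs : s ∈ C.I) :
    inner ℝ (deriv C.v s) (deriv C.v s) + inner ℝ (C.v s) (deriv (deriv C.v) s) = (0 : ℝ) := by
  have hv := hasDerivAt_of_contDiffOn C.isOpen_I C.smooth_v hs
  exact hasDerivAt_inner_eq_zero hv.1 hv.2 (k := 0) (by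
    filter_upwards [C.isOpen_I.mem_nhds hs] with t ht using inner_v_deriv_v ht)

theorem inner_deriv_deriv_u_v {s : ℝ} (hs : s ∈ C.I) :
    inner ℝ (deriv (deriv C.u) s) (C.v s) + 2 * inner ℝ (deriv C.u s) (deriv C.v s)
      + inner ℝ (C.u s) (deriv (deriv C.v) s) = (0 : ℝ) := by
  have hu := hasDerivAt_of_contDiffOn C.isOpen_I C.smooth_u hs
  have hv := hasDerivAt_of_contDiffOn C.isOpen_I C.smooth_v hs
  have h1 := (hu.2.inner ℝ hv.1).add (hu.1.inner ℝ hv.2)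
  have h2 : HasDerivAt (fun t => inner ℝ (deriv C.u t) (C.v t) + inner ℝ (C.u t) (deriv C.v t))
      (0 : ℝ) s := (hasDerivAt_const s 0).congr_of_eventuallyEq (by
    filter_upwards [C.isOpen_I.mem_nhds hs] with t ht using inner_deriv_u_v ht)
  linarith [h1.unique h2]

/-! ### Minimal cyclic surfaces near a non-horizontal plane -/

variable {U : Set (ℝ × ℝ)}

theorem exists_eventually_defect_eq_zero (hU : C.IsDomain U)
    (hmin : IsDirichletMinimalOn C.param U) {s : ℝ} (hs : s ∈ C.I) :
    ∃ θ₀, (s, θ₀) ∈ U ∧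
      ∀ᶠ θ in nhds θ₀, (C.jet s).defect 1 (Real.cos θ) (Real.sin θ) = 0 := by
  obtain ⟨θ₀, hθ₀⟩ := hU.2.2 s hs
  refine ⟨θ₀, hθ₀, ?_⟩
  have hcont : Continuous fun θ : ℝ => (s, θ) := by fun_prop
  filter_upwards [hcont.continuousAt.eventually (hU.1.mem_nhds hθ₀)] with θ hθ
  exact defect_jet_eq_zero hU hmin hθ

/-- Where the planes of the circles are not horizontal, `u, v` rotate in a fixed plane. -/
theorem deriv_u_v_eq (hU : C.IsDomain U) (hmin : IsDirichletMinimalOn C.param U) {s : ℝ}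
    (hs : s ∈ C.I) (hne : ¬ (C.u s 2 = 0 ∧ C.v s 2 = 0)) :
    deriv C.u s = (inner ℝ (C.v s) (deriv C.u s) : ℝ) • C.v s ∧
      deriv C.v s = -(inner ℝ (C.v s) (deriv C.u s) : ℝ) • C.u s := by
  obtain ⟨θ₀, -, h⟩ := exists_eventually_defect_eq_zero hU hmin hs
  have key := (C.jet s).tripleDet_eq_zero (C.r_pos s hs).ne' (by
      simpa only [jet, inner_eq_dotProduct] using inner_u_u hs) (by
      simpa only [jet, inner_eq_dotProduct] using inner_v_v hs) (by
      simpa only [jet, inner_eq_dotProduct] using C.inner_u_v s hs) (by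
      simpa only [jet, inner_eq_dotProduct] using inner_u_deriv_u hs) (by
      simpa only [jet, inner_eq_dotProduct] using inner_v_deriv_v hs) (by
      simpa only [jet, inner_eq_dotProduct] using inner_deriv_u_v hs) (by
      simpa only [jet, inner_eq_dotProduct] using inner_u_deriv_deriv_u hs) (by
      simpa only [jet, inner_eq_dotProduct] using inner_v_deriv_deriv_v hs) (by
      simpa only [jet, inner_eq_dotProduct] using inner_deriv_deriv_u_v hs) hne h
  have hu := eq_of_tripleDet_eq_zero (inner_u_u hs) (inner_v_v hs) (C.inner_u_v s hs) key.1
  have hv := eq_of_tripleDet_eq_zero (inner_u_u hs) (inner_v_v hs) (C.inner_u_v s hs) key.2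
  rw [inner_u_deriv_u hs, zero_smul, zero_add] at hu
  rw [inner_v_deriv_v hs, zero_smul, add_zero] at hv
  refine ⟨hu, ?_⟩
  have e := inner_deriv_u_v hs
  rw [real_inner_comm] at e
  rw [← eq_neg_of_add_eq_zero_right e]
  exact hv

theorem hasDerivAt_cross_u_v (hU : C.IsDomain U) (hmin : IsDirichletMinimalOn C.param U) {s : ℝ}
    (hs : s ∈ C.I) (hne : ¬ (C.u s 2 = 0 ∧ C.v s 2 = 0)) :
    HasDerivAt (fun t => cross (C.u t) (C.v t)) 0 s := by
  obtain ⟨h1, h2⟩ := deriv_u_v_eq hU hmin hs hne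
  convert hasDerivAt_cross (hasDerivAt_of_contDiffOn C.isOpen_I C.smooth_u hs).1
    (hasDerivAt_of_contDiffOn C.isOpen_I C.smooth_v hs).1 using 1
  rw [h1, h2]
  ext i
  fin_cases i <;> simp [cross, crossProduct] <;> ring

theorem eventually_not_horizontal {s : ℝ} (hs : s ∈ C.I) (hne : ¬ (C.u s 2 = 0 ∧ C.v s 2 = 0)) :
    ∀ᶠ t in nhds s, t ∈ C.I ∧ ¬ (C.u t 2 = 0 ∧ C.v t 2 = 0) := by
  have hu := (hasDerivAt_of_contDiffOn C.isOpen_I C.smooth_u hs).1.continuousAt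
  have hv := (hasDerivAt_of_contDiffOn C.isOpen_I C.smooth_v hs).1.continuousAt
  have hproj : Continuous fun x : E3 => x 2 := by fun_prop
  have hu2 : ContinuousAt (fun t => C.u t 2) s := hproj.continuousAt.comp hu
  have hv2 : ContinuousAt (fun t => C.v t 2) s := hproj.continuousAt.comp hv
  refine Filter.Eventually.and (C.isOpen_I.mem_nhds hs) ?_
  by_cases h : C.u s 2 = 0
  · filter_upwards [hv2.eventually_ne fun h' => hne ⟨h, h'⟩] with t ht h0 using ht h0.2
  · filter_upwards [hu2.eventually_ne h] with t ht h0 using ht h0.1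

/-- Where the planes of the circles are not horizontal, the circles move within their plane. -/
theorem inner_cross_deriv_c (hU : C.IsDomain U) (hmin : IsDirichletMinimalOn C.param U) {s : ℝ}
    (hs : s ∈ C.I) (hne : ¬ (C.u s 2 = 0 ∧ C.v s 2 = 0)) :
    inner ℝ (cross (C.u s) (C.v s)) (deriv C.c s) = (0 : ℝ) := by
  obtain ⟨θ₀, hθ₀, h⟩ := exists_eventually_defect_eq_zero hU hmin hs
  obtain ⟨h1, h2⟩ := deriv_u_v_eq hU hmin hs hne
  set φ := (inner ℝ (C.v s) (deriv C.u s) : ℝ)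
  have hn := hasDerivAt_cross_u_v hU hmin hs hne
  have hu := (hasDerivAt_of_contDiffOn C.isOpen_I C.smooth_u hs).2
  have hv := (hasDerivAt_of_contDiffOn C.isOpen_I C.smooth_v hs).2
  -- Non-horizontality is an open condition, so n·u' = 0 and n·v' = 0 hold near s. Differentiating
  -- with n' = 0 puts u'' and v'' in span{u, v} as well.
  have du := hasDerivAt_inner_eq_zero hn hu (k := 0) (by
    filter_upwards [eventually_not_horizontal hs hne] with t ht
    rw [(deriv_u_v_eq hU hmin ht.1 ht.2).1, real_inner_smul_right, inner_cross_left, tripleDet]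
    ring)
  have dv := hasDerivAt_inner_eq_zero hn hv (k := 0) (by
    filter_upwards [eventually_not_horizontal hs hne] with t ht
    rw [(deriv_u_v_eq hU hmin ht.1 ht.2).2, real_inner_smul_right, inner_cross_left, tripleDet]
    ring)
  rw [inner_zero_left, zero_add, inner_cross_left] at du dv
  have hu₂ := eq_of_tripleDet_eq_zero (inner_u_u hs) (inner_v_v hs) (C.inner_u_v s hs) du
  have hv₂ := eq_of_tripleDet_eq_zero (inner_u_u hs) (inner_v_v hs) (C.inner_u_v s hs) dv
  have e1 := inner_u_deriv_deriv_u hs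
  have e2 := inner_v_deriv_deriv_v hs
  have e3 := inner_deriv_deriv_u_v hs
  rw [h1, real_inner_smul_left, real_inner_smul_right, inner_v_v hs] at e1
  rw [h2, real_inner_smul_left, real_inner_smul_right, inner_u_u hs] at e2
  rw [h1, h2, real_inner_smul_left, real_inner_smul_right, real_inner_comm (C.u s) (C.v s),
    C.inner_u_v s hs, real_inner_comm] at e3
  set ψ := (inner ℝ (C.v s) (deriv (deriv C.u) s) : ℝ)
  rw [show (inner ℝ (C.u s) (deriv (deriv C.u) s) : ℝ) = -φ ^ 2 by linarith] at hu₂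
  rw [show (inner ℝ (C.v s) (deriv (deriv C.v) s) : ℝ) = -φ ^ 2 by linarith,
    show (inner ℝ (C.u s) (deriv (deriv C.v) s) : ℝ) = -ψ by linarith] at hv₂
  by_contra hη
  rw [inner_cross_left] at hη
  have key := (C.jet s).vertical_of_parallel (φ := φ) (ψ := ψ) (C.r_pos s hs).ne' (by
      simpa only [jet, inner_eq_dotProduct] using inner_u_u hs) (by
      simpa only [jet, inner_eq_dotProduct] using inner_v_v hs) (by
      simpa only [jet, inner_eq_dotProduct] using C.inner_u_v s hs)
      (fun i => by simpa [jet] using congrArg (fun x : E3 => x i) h1)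
      (fun i => by simpa [jet] using congrArg (fun x : E3 => x i) h2)
      (fun i => by simpa [jet] using congrArg (fun x : E3 => x i) hu₂)
      (fun i => by
        have := congrArg (fun x : E3 => x i) hv₂
        simp only [PiLp.add_apply, PiLp.smul_apply, smul_eq_mul] at this
        simp only [jet]
        linear_combination this)
      hne hη (fun _ _ hCS => (C.jet s).defect_real_eq_zero h hCS) (Real.cos θ₀) (Real.sin θ₀)
  -- The vanishing expression is the third component of X_s × X_θ, against ν₃ ≠ 0.
  rw [← partialS_param_eq_derS hs, ← partialT_param_eq_derT, ← cross_apply_two] at key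
  refine (hmin _ hθ₀).2.1 ?_
  rw [unitNormal, PiLp.smul_apply, normalVec, key, smul_zero]

/-! ### Constant inclination and planarity -/

theorem isPreconnected_I : IsPreconnected C.I := C.ordConnected_I.isPreconnected

/-- The inclination of the planes of the circles is constant. -/
theorem inclination_eq (hU : C.IsDomain U) (hmin : IsDirichletMinimalOn C.param U) {s t : ℝ}
    (hs : s ∈ C.I) (ht : t ∈ C.I) :
    C.u s 2 ^ 2 + C.v s 2 ^ 2 = C.u t 2 ^ 2 + C.v t 2 ^ 2 := by
  have hd : ∀ x ∈ C.I, HasDerivAt (fun x => C.u x 2 ^ 2 + C.v x 2 ^ 2) 0 x := by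
    intro x hx
    have hu := hasDerivAt_coord (hasDerivAt_of_contDiffOn C.isOpen_I C.smooth_u hx).1 2
    have hv := hasDerivAt_coord (hasDerivAt_of_contDiffOn C.isOpen_I C.smooth_v hx).1 2
    refine ((hu.pow 2).add (hv.pow 2)).congr_deriv ?_
    -- A sum of squares is critical at its zeros, so horizontal planes need no information on u',
    -- v'; elsewhere u' = φv and v' = -φu make the terms cancel.
    by_cases hne : C.u x 2 = 0 ∧ C.v x 2 = 0
    · simp [hne.1, hne.2]
    · obtain ⟨h1, h2⟩ := deriv_u_v_eq hU hmin hx hne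
      rw [h1, h2]
      simp only [PiLp.smul_apply, smul_eq_mul]
      ring
  exact C.isOpen_I.is_const_of_deriv_eq_zero isPreconnected_I
    (fun x hx => (hd x hx).differentiableAt.differentiableWithinAt)
    (fun x hx => (hd x hx).deriv) hs ht

/-- If no plane of the foliation is horizontal, then the surface lies in a plane. -/
theorem coplanar_surface (hU : C.IsDomain U) (hmin : IsDirichletMinimalOn C.param U)
    (hne : ∀ s ∈ C.I, ¬ (C.u s 2 = 0 ∧ C.v s 2 = 0)) : Coplanar ℝ (C.surface U) := by
  have hconst : ∀ s ∈ C.I, ∀ t ∈ C.I, cross (C.u s) (C.v s) = cross (C.u t) (C.v t) :=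
    fun s hs t ht => C.isOpen_I.is_const_of_deriv_eq_zero (𝕜 := ℝ)
      (f := fun s => cross (C.u s) (C.v s)) isPreconnected_I
      (fun x hx => (hasDerivAt_cross_u_v hU hmin hx
        (hne x hx)).differentiableAt.differentiableWithinAt)
      (fun x hx => (hasDerivAt_cross_u_v hU hmin hx (hne x hx)).deriv) hs ht
  have hcder : ∀ s ∈ C.I, HasDerivAt (fun t => inner ℝ (cross (C.u t) (C.v t)) (C.c t))
      (0 : ℝ) s := fun s hs => by
    refine ((hasDerivAt_cross_u_v hU hmin hs (hne s hs)).inner ℝ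
      (hasDerivAt_of_contDiffOn C.isOpen_I C.smooth_c hs).1).congr_deriv ?_
    rw [inner_cross_deriv_c hU hmin hs (hne s hs), inner_zero_left, add_zero]
  have hc : ∀ s ∈ C.I, ∀ t ∈ C.I, (inner ℝ (cross (C.u s) (C.v s)) (C.c s) : ℝ) =
      inner ℝ (cross (C.u t) (C.v t)) (C.c t) :=
    fun s hs t ht => C.isOpen_I.is_const_of_deriv_eq_zero (𝕜 := ℝ)
      (f := fun t => (inner ℝ (cross (C.u t) (C.v t)) (C.c t) : ℝ)) isPreconnected_I
      (fun x hx => (hcder x hx).differentiableAt.differentiableWithinAt)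
      (fun x hx => (hcder x hx).deriv) hs ht
  have hX : ∀ s θ, (inner ℝ (cross (C.u s) (C.v s)) (C.param s θ) : ℝ) =
      inner ℝ (cross (C.u s) (C.v s)) (C.c s) := fun s θ => by
    have h1 : (inner ℝ (cross (C.u s) (C.v s)) (C.u s) : ℝ) = 0 := by
      rw [inner_cross_left, tripleDet]; ring
    have h2 : (inner ℝ (cross (C.u s) (C.v s)) (C.v s) : ℝ) = 0 := by
      rw [inner_cross_left, tripleDet]; ring
    simp only [param, inner_add_right, real_inner_smul_right, h1, h2, mul_zero, add_zero]
  rcases C.I.eq_empty_or_nonempty with hI | ⟨s₀, hs₀⟩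
  · have : C.surface U = ∅ := by
      rw [surface, Set.image_eq_empty]
      refine Set.eq_empty_of_forall_notMem fun p hp => ?_
      have := hU.2.1 p hp
      rw [hI] at this
      exact this
    rw [this]
    exact coplanar_empty ℝ E3
  set n := cross (C.u s₀) (C.v s₀) with hn
  have hn0 : n ≠ 0 := by
    intro h0
    have := inner_self_cross (C.u s₀) (C.v s₀)
    rw [← hn, h0, inner_u_u hs₀, inner_v_v hs₀, C.inner_u_v s₀ hs₀] at this
    simp at this
  -- The function n·x is constant on the surface, and the orthogonal complement of n has dimension
  -- 2.
  have hle : vectorSpan ℝ (C.surface U) ≤ (Submodule.span ℝ {n})ᗮ := by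
    rw [vectorSpan_def, Submodule.span_le]
    rintro _ ⟨_, ⟨p, hp, rfl⟩, _, ⟨q, hq, rfl⟩, rfl⟩
    have hp' := hU.2.1 p hp
    have hq' := hU.2.1 q hq
    simp only [SetLike.mem_coe, Submodule.mem_orthogonal_singleton_iff_inner_right, vsub_eq_sub,
      inner_sub_right, sub_eq_zero]
    rw [hn, hconst s₀ hs₀ p.1 hp', hX, hc p.1 hp' q.1 hq', ← hX q.1 q.2,
      hconst p.1 hp' q.1 hq']
  have : Fact (Module.finrank ℝ E3 = 2 + 1) := ⟨by simp⟩
  have hrank := Submodule.rank_mono hle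
  rw [← Module.finrank_eq_rank ℝ ((Submodule.span ℝ {n})ᗮ : Submodule ℝ E3),
    Submodule.finrank_orthogonal_span_singleton (n := 2) hn0] at hrank
  exact_mod_cast hrank

/-- A plane spanned by horizontal orthonormal vectors is parallel to the `xy`-plane. -/
theorem parallel_xyPlane {s : ℝ} (hs : s ∈ C.I) (hu : C.u s 2 = 0) (hv : C.v s 2 = 0) :
    (C.plane s).Parallel xyPlane := by
  have hle : Submodule.span ℝ {C.u s, C.v s} ≤
      Submodule.span ℝ {(EuclideanSpace.single 0 1 : E3), EuclideanSpace.single 1 1} := by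
    have : ∀ x : E3, x 2 = 0 →
        x ∈ Submodule.span ℝ {(EuclideanSpace.single 0 1 : E3), EuclideanSpace.single 1 1} := by
      intro x hx
      rw [Submodule.mem_span_pair]
      refine ⟨x 0, x 1, ?_⟩
      ext i
      fin_cases i <;> simp [hx]
    rw [Submodule.span_le]
    rintro x (rfl | rfl)
    exacts [this _ hu, this _ hv]
  have hli : LinearIndependent ℝ ![C.u s, C.v s] := by
    rw [LinearIndependent.pair_iff]
    intro a b hab
    have h1 := congrArg (fun x => (inner ℝ (C.u s) x : ℝ)) hab
    have h2 := congrArg (fun x => (inner ℝ (C.v s) x : ℝ)) hab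
    simp only [inner_add_right, real_inner_smul_right, inner_u_u hs, inner_v_v hs,
      real_inner_comm (C.u s) (C.v s), C.inner_u_v s hs, inner_zero_right] at h1 h2
    exact ⟨by linarith, by linarith⟩
  have hrank : Module.finrank ℝ (Submodule.span ℝ {C.u s, C.v s}) = 2 := by
    have := finrank_span_eq_card hli
    rwa [Matrix.range_cons_cons_empty, Fintype.card_fin] at this
  have heq := Submodule.eq_of_le_of_finrank_le hle (by
    rw [hrank]
    classical
    refine (finrank_span_le_card _).trans ?_
    rw [Set.toFinset_insert, Set.toFinset_singleton]
    exact Finset.card_le_two)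
  rw [AffineSubspace.parallel_iff_direction_eq_and_eq_bot_iff_eq_bot]
  refine ⟨by rw [plane, xyPlane, AffineSubspace.direction_mk', AffineSubspace.direction_mk', heq],
    ?_⟩
  have h1 : C.plane s ≠ ⊥ := by
    rw [← AffineSubspace.nonempty_iff_ne_bot]; exact AffineSubspace.mk'_nonempty _ _
  have h2 : xyPlane ≠ ⊥ := by
    rw [← AffineSubspace.nonempty_iff_ne_bot]; exact AffineSubspace.mk'_nonempty _ _
  simp [h1, h2]

end CircleFamily

theorem theorem1p3 (C : CircleFamily) (U : Set (ℝ × ℝ)) (hU : C.IsDomain U)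
    (hmin : IsDirichletMinimalOn C.param U)
    (hplane : ¬ Coplanar ℝ (C.surface U)) :
    ∀ s ∈ C.I, (C.plane s).Parallel xyPlane := by
  intro s hs
  have h : C.u s 2 = 0 ∧ C.v s 2 = 0 := by
    by_contra hne
    -- A single horizontal plane, at t, would give inclination 0 at s too.
    refine hplane (CircleFamily.coplanar_surface hU hmin fun t ht h0 => hne ?_)
    have := CircleFamily.inclination_eq hU hmin hs ht
    rw [h0.1, h0.2] at this
    norm_num at this
    obtain ⟨h1, h2⟩ := (add_eq_zero_iff_of_nonneg (sq_nonneg _) (sq_nonneg _)).1 this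
    exact ⟨by simpa using h1, by simpa using h2⟩
  exact CircleFamily.parallel_xyPlane hs h.1 h.2
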